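/- Let $\Theta$ be an ergodic stationary point process on $\mathbb{R}$ (a random locally finite collection of points, possibly with multiplicities) with finite intensity, $E|\Theta\cap[0,1)|<\infty$. Let $\varepsilon>0$, let $p_\varepsilon$ be the density of the normal distribution with mean $0$ and variance $\varepsilon$, and let $a\le b$ be real numbers. Let $$Af=\sum_{\theta\in\Theta}\Big(\int_{\mathbb{R}}f(u)\,p_\varepsilon(u-\theta)\,du\Big)\,p_\varepsilon(\cdot-\theta),$$ and let $Q_{a,b}$ be the projection of $L_2(\mathbb{R})$ onto $L_2([a,b])$ (multiplication by the indicator function of $[a,b]$). Then with probability one the following holds. For every $f\in L_2(\mathbb{R})$ the series defining $AQ_{a,b}f$ converges unconditionally in $L_2(\mathbb{R})$; the operator $Q_{a,b}AQ_{a,b}$ is nuclear; and, if $K$ denotes the image of the closed unit ball of $L_2([a,b])$ under $Q_{a,b}AQ_{a,b}$ and $$d_n(K)=\inf_{\dim L\le n}\ \sup_{x\in K}\ \operatorname{dist}(x,L)$$ (the infimum over linear subspaces $L$ of $L_2(\mathbb{R})$) is its Kolmogorov $n$-width, then there exists $C>0$ (which may depend on the realization of $\Theta$) such that $$d_n(K)=O\left(e^{-\frac{(Cn-b)^2}{\varepsilon}}\vee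 e^{-\frac{(Cn+a)^2}{\varepsilon}}\right),\qquad n\to\infty.$$ -/

import Mathlib

open MeasureTheory ProbabilityTheory Filter Topology
open scoped NNReal ENNReal

noncomputable section

/-- A realization of a point process on the line: a locally finite collection of real points,
the point `θ` being counted `mult θ` times. A locally finite set of points is the case where
`mult` takes the values `0` and `1` only. -/
@[ext]
structure PointConfig where
  mult : ℝ → ℕ
  finite_Icc : ∀ a b : ℝ, (Function.support mult ∩ Set.Icc a b).Finite

namespace PointConfig

/-- The number of points of `S` in `B`, with multiplicity. -/
def count (S : PointConfig) (B : Set ℝ) : ℝ≥0∞ := ∑' θ : B, (S.mult θ : ℝ≥0∞)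

/-- The σ-algebra generated by the numbers of points in Borel sets. -/
instance instMeasurableSpace : MeasurableSpace PointConfig :=
  ⨆ (B : Set ℝ) (_ : MeasurableSet B),
    MeasurableSpace.comap (fun S : PointConfig => S.count B) inferInstance

/-- The configuration `S + t`, in which every point of `S` is moved by `t`. -/
def shift (t : ℝ) (S : PointConfig) : PointConfig where
  mult x := S.mult (x - t)
  finite_Icc a b := by
    refine ((S.finite_Icc (a - t) (b - t)).image (fun y => y + t)).subset ?_
    rintro x ⟨hx, hxa, hxb⟩
    exact ⟨x - t, ⟨hx, by linarith, by linarith⟩, by simp⟩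

instance instAddAction : AddAction ℝ PointConfig where
  vadd := shift
  zero_vadd S := by
    ext x
    change S.mult (x - 0) = S.mult x
    rw [sub_zero]
  add_vadd s t S := by
    ext x
    change S.mult (x - (s + t)) = S.mult (x - s - t)
    rw [sub_sub]

end PointConfig

/-- The law of the point process is invariant under translations of the line, and every event
that is invariant under every translation (up to null events) has probability `0` or `1`. -/
def IsErgodicStationary {Ω : Type*} [MeasurableSpace Ω] (P : Measure Ω) (Θ : Ω → PointConfig) :
    Prop :=
  ErgodicVAdd ℝ PointConfig (P.map Θ)

/-- The real space `L₂(ℝ)`. -/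
abbrev RealL2 : Type := Lp ℝ 2 (volume : Measure ℝ)

/-- The subspace `L₂([a, b])` of `L₂(ℝ)`. -/
def l2Icc (a b : ℝ) : Submodule ℝ RealL2 where
  carrier := {f | ∀ᵐ u, u ∉ Set.Icc a b → f u = 0}
  add_mem' {f g} hf hg := by
    filter_upwards [hf, hg, Lp.coeFn_add f g] with u h1 h2 h3 hu
    rw [h3, Pi.add_apply, h1 hu, h2 hu, add_zero]
  zero_mem' := by
    filter_upwards [Lp.coeFn_zero ℝ 2 (volume : Measure ℝ)] with u h1 _
    rw [h1, Pi.zero_apply]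
  smul_mem' c f hf := by
    filter_upwards [hf, Lp.coeFn_smul c f] with u h1 h2 hu
    rw [h2, Pi.smul_apply, h1 hu, smul_zero]

/-- The projection `Q` of `L₂(ℝ)` onto `L₂([a, b])`: multiplication by the indicator function
of `[a, b]`. -/
def projIcc (a b : ℝ) (f : RealL2) : RealL2 :=
  ((Lp.memLp f).indicator (measurableSet_Icc (a := a) (b := b))).toLp

theorem memLp_gaussianPDFReal_sub (ε : ℝ≥0) (θ : ℝ) :
    MemLp (fun u : ℝ => gaussianPDFReal 0 ε (u - θ)) 2 volume := by
  have hm : AEStronglyMeasurable (fun u : ℝ => gaussianPDFReal 0 ε (u - θ)) volume :=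
    ((stronglyMeasurable_gaussianPDFReal 0 ε).comp_measurable
      (measurable_id.sub_const θ)).aestronglyMeasurable
  rw [memLp_two_iff_integrable_sq hm]
  have hi : Integrable (fun u : ℝ => gaussianPDFReal 0 ε (u - θ)) volume :=
    (integrable_gaussianPDFReal 0 ε).comp_sub_right θ
  have hb : ∀ᵐ u : ℝ, ‖gaussianPDFReal 0 ε (u - θ)‖ ≤ (√(2 * Real.pi * ε))⁻¹ := by
    refine Eventually.of_forall fun u => ?_
    rw [Real.norm_of_nonneg (gaussianPDFReal_nonneg _ _ _), gaussianPDFReal]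
    refine mul_le_of_le_one_right (by positivity) (Real.exp_le_one_iff.2 ?_)
    rw [neg_div]
    exact neg_nonpos.2 (by positivity)
  refine (hi.bdd_mul hm hb).congr (Eventually.of_forall fun u => ?_)
  simp [sq]

/-- The function `u ↦ p_ε(u - θ)` as an element of `L₂(ℝ)`, where `p_ε` is the density of the
centred normal distribution with variance `ε`. -/
def gaussianShift (ε : ℝ≥0) (θ : ℝ) : RealL2 := (memLp_gaussianPDFReal_sub ε θ).toLp

/-- The contribution of the point `θ` (with its multiplicity) to `A f`. -/
def operatorTerm (ε : ℝ≥0) (S : PointConfig) (f : RealL2) (θ : ℝ) : RealL2 :=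
  ((S.mult θ : ℝ) * ∫ u, f u * gaussianPDFReal 0 ε (u - θ)) • gaussianShift ε θ

/-- The operator `A f = ∑_θ (∫ f(u) p_ε(u - θ) du) p_ε(· - θ)`, the sum being over the points
`θ` of `S` and convergent in `L₂(ℝ)`. -/
def operatorA (ε : ℝ≥0) (S : PointConfig) (f : RealL2) : RealL2 :=
  ∑' θ : ℝ, operatorTerm ε S f θ

/-- The operator `Q A Q`. -/
def operatorQAQ (ε : ℝ≥0) (a b : ℝ) (S : PointConfig) (f : RealL2) : RealL2 :=
  projIcc a b (operatorA ε S (projIcc a b f))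

/-- The image under `Q A Q` of the unit ball of `L₂([a, b])`. -/
def imageUnitBall (ε : ℝ≥0) (a b : ℝ) (S : PointConfig) : Set RealL2 :=
  operatorQAQ ε a b S '' {f | f ∈ l2Icc a b ∧ ‖f‖ ≤ 1}

/-- `T` is nuclear: `T x = ∑ φ_k(x) y_k` with `∑ ‖φ_k‖ ‖y_k‖ < ∞`. -/
def IsNuclear {E F : Type*} [NormedAddCommGroup E] [NormedSpace ℝ E]
    [NormedAddCommGroup F] [NormedSpace ℝ F] (T : E → F) : Prop :=
  ∃ (φ : ℕ → E →L[ℝ] ℝ) (y : ℕ → F), Summable (fun k => ‖φ k‖ * ‖y k‖) ∧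
    ∀ x, HasSum (fun k => φ k x • y k) (T x)

/-- The Kolmogorov `n`-width of `K`: the infimum, over the subspaces `L` of dimension at most
`n`, of the supremum over `x ∈ K` of the distance from `x` to `L`. -/
def kolmogorovWidth {E : Type*} [NormedAddCommGroup E] [NormedSpace ℝ E] (K : Set E) (n : ℕ) :
    ℝ≥0∞ :=
  ⨅ (L : Submodule ℝ E) (_ : FiniteDimensional ℝ L ∧ Module.finrank ℝ L ≤ n),
    ⨆ x ∈ K, Metric.infEDist x (L : Set E)

end

/-! Write `g_θ` for the restriction of `p_ε(· - θ)` to `[a, b]`. Then `QAQ f = ∑ mult(θ) ⟨f, g_θ⟩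
g_θ`, so everything rests on two facts: the points are not too dense, and `‖g_θ‖` decays like a
Gaussian in `θ`.

Density: by the maximal ergodic theorem for the unit shifts in both directions, almost surely `[-R,
R]` holds at most `D R` points for all `R ≥ 1` (`ae_count_Icc_le_linear`). A bound on the Birkhoff
averages suffices; their limit is not needed.

Decay: `∑ mult(θ) exp(-θ²/(4ε))` is then finite, which gives convergence and nuclearity. For the
width take `c = n/(2D)`: at most `n` points lie in `[-2c, 2c]`, and their `g_θ` span the
approximating subspace. On the unit ball the error is at most `∑ mult(θ) ‖g_θ‖²` over `|θ| > 2c`.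
There each `‖g_θ‖²` carries the factor `exp(-(c-b)²/ε)` or `exp(-(c+a)²/ε)` and still keeps the
summable weight `exp(-θ²/(4ε))`. -/

/-! ### Maximal ergodic theorem and linear growth of Birkhoff sums -/

section MaximalErgodic

variable {α : Type*}

/-- The maximum of the Birkhoff sums of `g` of length at most `n`, including the empty sum. -/
def birkhoffMax (T : α → α) (g : α → ℝ) : ℕ → α → ℝ
  | 0, _ => 0
  | n + 1, x => max 0 (g x + birkhoffMax T g n (T x))

theorem birkhoffMax_nonneg (T : α → α) (g : α → ℝ) (n : ℕ) (x : α) :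
    0 ≤ birkhoffMax T g n x := by
  cases n with
  | zero => exact le_rfl
  | succ n => exact le_max_left _ _

theorem birkhoffMax_le_succ (T : α → α) (g : α → ℝ) (n : ℕ) (x : α) :
    birkhoffMax T g n x ≤ birkhoffMax T g (n + 1) x := by
  induction n generalizing x with
  | zero => exact birkhoffMax_nonneg T g 1 x
  | succ n ih => exact max_le_max le_rfl (add_le_add le_rfl (ih (T x)))

/-- A positive maximum is not attained by the empty sum, so the recursion drops its `max 0`. -/
theorem birkhoffMax_le_add (T : α → α) (g : α → ℝ) (n : ℕ) (x : α)
    (hx : 0 < birkhoffMax T g n x) : birkhoffMax T g n x ≤ g x + birkhoffMax T g n (T x) := by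
  cases n with
  | zero => exact absurd hx (lt_irrefl _)
  | succ n =>
    have h : birkhoffMax T g (n + 1) x = g x + birkhoffMax T g n (T x) := by
      rcases max_choice 0 (g x + birkhoffMax T g n (T x)) with h | h
      · exact absurd (hx.trans_eq h) (lt_irrefl _)
      · exact h
    rw [h]
    exact add_le_add le_rfl (birkhoffMax_le_succ T g n (T x))

theorem birkhoffSum_le_birkhoffMax (T : α → α) (g : α → ℝ) (n : ℕ) (x : α) :
    birkhoffSum T g n x ≤ birkhoffMax T g n x := by
  induction n generalizing x with
  | zero => simp [birkhoffMax]
  | succ n ih =>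
    rw [birkhoffSum_succ']
    exact (add_le_add le_rfl (ih (T x))).trans (le_max_right _ _)

variable [MeasurableSpace α] {μ : Measure α} {T : α → α} {g : α → ℝ}

theorem measurable_birkhoffMax (hT : Measurable T) (hg : Measurable g) (n : ℕ) :
    Measurable (birkhoffMax T g n) := by
  induction n with
  | zero => exact measurable_const
  | succ n ih => exact measurable_const.max (hg.add (ih.comp hT))

theorem integrable_birkhoffMax (hT : MeasurePreserving T μ μ) (hg : Integrable g μ) (n : ℕ) :
    Integrable (birkhoffMax T g n) μ := by
  induction n with
  | zero => exact integrable_zero _ _ _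
  | succ n ih =>
    exact (integrable_zero _ _ _).sup (hg.add (hT.integrable_comp_of_integrable ih))

/-- The maximal ergodic theorem. -/
theorem setIntegral_birkhoffMax_pos_nonneg (hT : MeasurePreserving T μ μ) (hgm : Measurable g)
    (hg : Integrable g μ) (n : ℕ) : 0 ≤ ∫ x in {x | 0 < birkhoffMax T g n x}, g x ∂μ := by
  set M := birkhoffMax T g n with hM
  have hMm : Measurable M := measurable_birkhoffMax hT.measurable hgm n
  have hMi : Integrable M μ := integrable_birkhoffMax hT hg n
  have hs : MeasurableSet {x | 0 < M x} := measurableSet_lt measurable_const hMm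
  have hMT : Integrable (fun x => M (T x)) μ := hT.integrable_comp_of_integrable hMi
  -- Garsia's argument: `M - M ∘ T` has integral zero, is at most `g` where `M > 0`, and is
  -- nonpositive elsewhere.
  have h0 : ∫ x, (M x - M (T x)) ∂μ = 0 := by
    have h : ∫ x, M (T x) ∂μ = ∫ x, M x ∂μ := by
      conv_rhs => rw [← hT.map_eq]
      rw [integral_map hT.aemeasurable hMm.aestronglyMeasurable]
    rw [integral_sub hMi hMT, h, sub_self]
  refine h0.ge.trans ?_
  rw [← integral_indicator hs]
  refine integral_mono (hMi.sub hMT) (hg.indicator hs) fun x => ?_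
  by_cases hx : 0 < M x
  · rw [Set.indicator_of_mem (by exact hx)]
    exact sub_le_iff_le_add.2 (birkhoffMax_le_add T g n x hx)
  · rw [Set.indicator_of_notMem (by exact hx)]
    exact sub_nonpos.2 ((not_lt.1 hx).trans (birkhoffMax_nonneg T g n _))

/-- The maximal ergodic theorem for `f - D` gives a weak-type bound on increasing events whose union
contains this one. -/
theorem measure_exists_lt_birkhoffSum_le [IsFiniteMeasure μ] (hT : MeasurePreserving T μ μ)
    {f : α → ℝ} (hfm : Measurable f) (hf : Integrable f μ) (hf0 : 0 ≤ f) {D : ℝ} (hD : 0 < D) :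
    μ {x | ∃ n : ℕ, D * n < birkhoffSum T f n x} ≤ ENNReal.ofReal ((∫ x, f x ∂μ) / D) := by
  set g : α → ℝ := fun x => f x - D
  have hg : Integrable g μ := hf.sub (integrable_const D)
  have hgm : Measurable g := hfm.sub_const D
  have hsum (n : ℕ) (x : α) : birkhoffSum T g n x = birkhoffSum T f n x - D * n := by
    simp [g, birkhoffSum, Finset.sum_sub_distrib, mul_comm]
  have hsub : {x | ∃ n : ℕ, D * n < birkhoffSum T f n x} ⊆
      ⋃ n, {x | 0 < birkhoffMax T g n x} := by
    rintro x ⟨n, hn⟩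
    refine Set.mem_iUnion.2 ⟨n, lt_of_lt_of_le ?_ (birkhoffSum_le_birkhoffMax T g n x)⟩
    rw [hsum]
    exact sub_pos.2 hn
  have hmono : Monotone fun n => {x | 0 < birkhoffMax T g n x} :=
    monotone_nat_of_le_succ fun n x hx => lt_of_lt_of_le hx (birkhoffMax_le_succ T g n x)
  refine (measure_mono hsub).trans ?_
  rw [hmono.measure_iUnion]
  refine iSup_le fun n => ?_
  have hs : MeasurableSet {x | 0 < birkhoffMax T g n x} :=
    measurableSet_lt measurable_const (measurable_birkhoffMax hT.measurable hgm n)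
  have h := setIntegral_birkhoffMax_pos_nonneg hT hgm hg n
  rw [integral_sub hf.integrableOn (integrable_const D).integrableOn, setIntegral_const,
    smul_eq_mul] at h
  have h2 : ∫ x in {x | 0 < birkhoffMax T g n x}, f x ∂μ ≤ ∫ x, f x ∂μ :=
    setIntegral_le_integral hf (Eventually.of_forall hf0)
  rw [← ofReal_measureReal]
  refine ENNReal.ofReal_le_ofReal ((le_div_iff₀ hD).2 ?_)
  linarith

/-- The exceptional event lies in that of the weak-type bound for every `D`; let `D → ∞`. -/
theorem ae_exists_birkhoffSum_le [IsFiniteMeasure μ] (hT : MeasurePreserving T μ μ)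
    {f : α → ℝ} (hfm : Measurable f) (hf : Integrable f μ) (hf0 : 0 ≤ f) :
    ∀ᵐ x ∂μ, ∃ D : ℝ, ∀ n : ℕ, birkhoffSum T f n x ≤ D * n := by
  rw [ae_iff]
  have hle (k : ℕ) : μ {x | ¬ ∃ D : ℝ, ∀ n : ℕ, birkhoffSum T f n x ≤ D * n} ≤
      ENNReal.ofReal ((∫ x, f x ∂μ) / ((k : ℝ) + 1)) := by
    refine (measure_mono fun x hx => ?_).trans
      (measure_exists_lt_birkhoffSum_le hT hfm hf hf0 k.cast_add_one_pos)
    have hx' := not_exists.1 hx ((k : ℝ) + 1)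
    push Not at hx'
    exact hx'
  have hlim : Tendsto (fun k : ℕ => ENNReal.ofReal ((∫ x, f x ∂μ) / ((k : ℝ) + 1))) atTop
      (𝓝 0) := by
    rw [← ENNReal.ofReal_zero]
    exact ENNReal.tendsto_ofReal (tendsto_const_nhds.div_atTop
      (tendsto_atTop_add_const_right _ _ tendsto_natCast_atTop_atTop))
  exact le_antisymm (ge_of_tendsto' hlim hle) zero_le

end MaximalErgodic

/-! ### Linear growth of a stationary configuration -/

namespace PointConfig

theorem count_ne_top_of_subset_Icc (S : PointConfig) {B : Set ℝ} {a b : ℝ}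
    (hB : B ⊆ Set.Icc a b) : S.count B ≠ ∞ := by
  have hfin : (Function.support fun θ : B => (S.mult θ : ℝ≥0∞)).Finite := by
    refine Set.Finite.of_finite_image (f := Subtype.val) ((S.finite_Icc a b).subset ?_)
      Subtype.val_injective.injOn
    rintro _ ⟨θ, hθ, rfl⟩
    exact ⟨fun h => hθ (by simp [h]), hB θ.2⟩
  rw [count, tsum_eq_sum (s := hfin.toFinset) (by simp)]
  exact ENNReal.sum_ne_top.2 fun _ _ => ENNReal.natCast_ne_top _

theorem measurable_count {B : Set ℝ} (hB : MeasurableSet B) :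
    Measurable fun S : PointConfig => S.count B :=
  Measurable.of_comap_le (le_iSup₂_of_le B hB le_rfl)

theorem count_vadd (t : ℝ) (S : PointConfig) (B : Set ℝ) :
    (t +ᵥ S).count B = S.count ((fun x => x + t) ⁻¹' B) := by
  let e : ((fun x => x + t) ⁻¹' B) ≃ B := (Equiv.addRight t).subtypeEquiv fun _ => Iff.rfl
  rw [count, count, ← e.tsum_eq]
  refine tsum_congr fun θ => ?_
  change ((S.mult (θ + t - t) : ℕ) : ℝ≥0∞) = _
  rw [add_sub_cancel_right]

instance : MeasurableConstVAdd ℝ PointConfig where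
  measurable_const_vadd t := by
    refine measurable_iff_comap_le.2 ?_
    simp only [instMeasurableSpace, MeasurableSpace.comap_iSup, MeasurableSpace.comap_comp]
    refine iSup₂_le fun B hB => ?_
    refine measurable_iff_comap_le.1 ?_
    have h : ((fun S : PointConfig => S.count B) ∘ fun S => t +ᵥ S) =
        fun S => S.count ((fun x => x + t) ⁻¹' B) := funext fun S => count_vadd t S B
    rw [h]
    exact measurable_count ((measurable_id.add_const t) hB)

theorem count_mono (S : PointConfig) {B B' : Set ℝ} (h : B ⊆ B') : S.count B ≤ S.count B' :=
  ENNReal.tsum_mono_subtype (fun θ => (S.mult θ : ℝ≥0∞)) h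

theorem count_union_le (S : PointConfig) (B B' : Set ℝ) :
    S.count (B ∪ B') ≤ S.count B + S.count B' :=
  ENNReal.tsum_union_le (fun θ => (S.mult θ : ℝ≥0∞)) B B'

theorem count_biUnion_le (S : PointConfig) (s : Finset ℕ) (B : ℕ → Set ℝ) :
    S.count (⋃ i ∈ s, B i) ≤ ∑ i ∈ s, S.count (B i) :=
  ENNReal.tsum_biUnion_le (fun θ => (S.mult θ : ℝ≥0∞)) s B

/-- A stationary point process of finite intensity has a.s. at most linearly many points in
`[-R, R]`. -/
theorem ae_count_Icc_le_linear {μ : Measure PointConfig} [IsFiniteMeasure μ]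
    [VAddInvariantMeasure ℝ PointConfig μ] (hint : ∫⁻ S, S.count (Set.Ico 0 1) ∂μ < ∞) :
    ∀ᵐ S ∂μ, ∃ D : ℝ, 0 < D ∧ ∀ R : ℝ, 1 ≤ R →
      S.count (Set.Icc (-R) R) ≤ ENNReal.ofReal (D * R) := by
  set f : PointConfig → ℝ := fun S => (S.count (Set.Ico 0 1)).toReal with hf
  have hfm : Measurable f := (measurable_count measurableSet_Ico).ennreal_toReal
  have hfi : Integrable f μ :=
    integrable_toReal_of_lintegral_ne_top (measurable_count measurableSet_Ico).aemeasurable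
      hint.ne
  have hf0 : 0 ≤ f := fun S => ENNReal.toReal_nonneg
  have hvadd (t : ℝ) (k : ℕ) (S : PointConfig) :
      ENNReal.ofReal (f (((t +ᵥ ·) : PointConfig → PointConfig)^[k] S)) =
        S.count (Set.Ico (-(k * t)) (1 - k * t)) := by
    have hk : ((t +ᵥ ·) : PointConfig → PointConfig)^[k] S = (k * t) +ᵥ S := by
      rw [vadd_iterate_apply, nsmul_eq_mul]
    rw [hk, hf]
    dsimp only
    rw [ENNReal.ofReal_toReal (count_ne_top_of_subset_Icc _ Set.Ico_subset_Icc_self), count_vadd]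
    simp
  have hsum (t : ℝ) (D : ℝ) (n : ℕ) (S : PointConfig)
      (h : birkhoffSum ((t +ᵥ ·) : PointConfig → PointConfig) f n S ≤ D * n) :
      S.count (⋃ k ∈ Finset.range n, Set.Ico (-(k * t)) (1 - k * t)) ≤
        ENNReal.ofReal (D * n) := by
    refine (count_biUnion_le S _ _).trans ((le_of_eq ?_).trans (ENNReal.ofReal_le_ofReal h))
    rw [birkhoffSum, ENNReal.ofReal_sum_of_nonneg fun k _ => hf0 _]
    exact Finset.sum_congr rfl fun k _ => (hvadd t k S).symm
  -- The shifts by `1` and `-1` count the cells `[-k, 1-k)` and `[k, k+1)`, which together cover the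
  -- line.
  filter_upwards [ae_exists_birkhoffSum_le (measurePreserving_vadd (1 : ℝ) μ) hfm hfi hf0,
    ae_exists_birkhoffSum_le (measurePreserving_vadd (-1 : ℝ) μ) hfm hfi hf0]
    with S ⟨D₁, h₁⟩ ⟨D₂, h₂⟩
  refine ⟨6 * (|D₁| + |D₂| + 1), by positivity, fun R hR => ?_⟩
  -- The margin `R < n - 1` absorbs the ceiling on the negative side. Two families of cells and `n ≤
  -- 3R` give the constant `6`.
  set n := ⌊R⌋₊ + 2 with hn
  have hRn : R < n - 1 := by
    have := Nat.lt_floor_add_one R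
    rw [hn]; push_cast; linarith
  have hnR : (n : ℝ) ≤ 3 * R := by
    have := Nat.floor_le (zero_le_one.trans hR)
    rw [hn]; push_cast; linarith
  have hsub : Set.Icc (-R) R ⊆
      (⋃ k ∈ Finset.range n, Set.Ico (-((k : ℝ) * 1)) (1 - k * 1)) ∪
        ⋃ k ∈ Finset.range n, Set.Ico (-((k : ℝ) * (-1))) (1 - k * (-1)) := by
    intro x hx
    rcases le_total 0 x with h | h
    · right
      refine Set.mem_biUnion (x := ⌊x⌋₊) ?_ ?_
      · rw [Finset.mem_coe, Finset.mem_range, Nat.floor_lt h]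
        linarith [hx.2]
      · have h1 := Nat.floor_le h
        have h2 := Nat.lt_floor_add_one x
        constructor <;> linarith
    · left
      refine Set.mem_biUnion (x := ⌈-x⌉₊) ?_ ?_
      · rw [Finset.mem_coe, Finset.mem_range, ← Nat.cast_lt (α := ℝ)]
        have h1 := Nat.ceil_lt_add_one (neg_nonneg.2 h)
        linarith [hx.1]
      · have h1 := Nat.ceil_lt_add_one (neg_nonneg.2 h)
        have h2 := Nat.le_ceil (-x)
        constructor <;> linarith
  refine (S.count_mono hsub).trans ((S.count_union_le _ _).trans ?_)
  have hK {D : ℝ} (hD : |D| ≤ |D₁| + |D₂| + 1) : D * n ≤ (|D₁| + |D₂| + 1) * n :=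
    mul_le_mul_of_nonneg_right ((le_abs_self D).trans hD) n.cast_nonneg
  have hD₁ : |D₁| ≤ |D₁| + |D₂| + 1 := by linarith [abs_nonneg D₂]
  have hD₂ : |D₂| ≤ |D₁| + |D₂| + 1 := by linarith [abs_nonneg D₁]
  refine (add_le_add (hsum _ _ n S ((h₁ n).trans (hK hD₁)))
    (hsum _ _ n S ((h₂ n).trans (hK hD₂)))).trans ?_
  rw [← ENNReal.ofReal_add (by positivity) (by positivity)]
  refine ENNReal.ofReal_le_ofReal ?_
  have := mul_le_mul_of_nonneg_left hnR (a := |D₁| + |D₂| + 1) (by positivity)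
  linarith

end PointConfig

/-! ### The projection onto `L₂([a, b])` -/

section Projection

variable (a b : ℝ)

theorem coeFn_projIcc (f : RealL2) : projIcc a b f =ᵐ[volume] (Set.Icc a b).indicator f :=
  MemLp.coeFn_toLp _

theorem norm_projIcc_le (f : RealL2) : ‖projIcc a b f‖ ≤ ‖f‖ := by
  refine Lp.norm_le_norm_of_ae_le ?_
  filter_upwards [coeFn_projIcc a b f] with u hu
  exact (congrArg norm hu).trans_le (norm_indicator_le_norm_self _ _)

/-- `projIcc a b` as a continuous linear map. -/
noncomputable def projIccCLM : RealL2 →L[ℝ] RealL2 :=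
  LinearMap.mkContinuous
    { toFun := projIcc a b
      map_add' := fun f g => by
        refine Lp.ext ?_
        filter_upwards [coeFn_projIcc a b (f + g), coeFn_projIcc a b f, coeFn_projIcc a b g,
          Lp.coeFn_add f g, Lp.coeFn_add (projIcc a b f) (projIcc a b g)] with u h1 h2 h3 h4 h5
        rw [h1, h5, Pi.add_apply, h2, h3]
        by_cases hu : u ∈ Set.Icc a b
        · simp only [Set.indicator_of_mem hu]
          exact h4
        · simp [hu]
      map_smul' := fun c f => by
        refine Lp.ext ?_
        filter_upwards [coeFn_projIcc a b (c • f), coeFn_projIcc a b f,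
          Lp.coeFn_smul c f, Lp.coeFn_smul c (projIcc a b f)] with u h1 h2 h3 h4
        rw [RingHom.id_apply, h1, h4, Pi.smul_apply, h2]
        by_cases hu : u ∈ Set.Icc a b <;> simp [hu, h3] }
    1 fun f => (norm_projIcc_le a b f).trans_eq (one_mul _).symm

@[simp]
theorem projIccCLM_apply (f : RealL2) : projIccCLM a b f = projIcc a b f := rfl

theorem inner_projIcc_left (f g : RealL2) :
    inner ℝ (projIcc a b f) g = inner ℝ (projIcc a b f) (projIcc a b g) := by
  rw [L2.inner_def, L2.inner_def]
  refine integral_congr_ae ?_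
  filter_upwards [coeFn_projIcc a b f, coeFn_projIcc a b g] with u h1 h2
  rw [h1, h2]
  by_cases hu : u ∈ Set.Icc a b <;> simp [hu]

theorem inner_projIcc_comm (f g : RealL2) :
    inner ℝ (projIcc a b f) g = inner ℝ f (projIcc a b g) := by
  rw [inner_projIcc_left, real_inner_comm, ← inner_projIcc_left, real_inner_comm]

theorem norm_projIcc_toLp_le {g : ℝ → ℝ} (hg : MemLp g 2 volume) {C : ℝ} (hC : 0 ≤ C)
    (h : ∀ u ∈ Set.Icc a b, ‖g u‖ ≤ C) : ‖projIcc a b hg.toLp‖ ≤ √(b - a) * C := by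
  have hcongr : eLpNorm ((Set.Icc a b).indicator hg.toLp) 2 volume =
      eLpNorm g 2 (volume.restrict (Set.Icc a b)) := by
    rw [eLpNorm_indicator_eq_eLpNorm_restrict measurableSet_Icc]
    exact eLpNorm_congr_ae (ae_restrict_of_ae hg.coeFn_toLp)
  rw [projIcc, Lp.norm_toLp, hcongr]
  refine ENNReal.toReal_le_of_le_ofReal (by positivity)
    ((eLpNorm_le_of_ae_bound (ae_restrict_of_forall_mem measurableSet_Icc h)).trans_eq ?_)
  rw [Measure.restrict_apply_univ, Real.volume_Icc, ENNReal.ofReal_mul (Real.sqrt_nonneg _),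
    Real.sqrt_eq_rpow, ENNReal.toReal_ofNat]
  congr 1
  rcases le_total a b with hab | hab
  · rw [← ENNReal.ofReal_rpow_of_nonneg (sub_nonneg.2 hab) (by norm_num)]
    norm_num
  -- For `b ≤ a` both sides vanish, since `√` is `0` at nonpositive arguments.
  · rw [ENNReal.ofReal_of_nonpos (sub_nonpos.2 hab), ← Real.sqrt_eq_rpow,
      Real.sqrt_eq_zero_of_nonpos (sub_nonpos.2 hab)]
    norm_num

end Projection

/-! ### Decay of restricted Gaussians -/

section GaussianShift

variable (ε : ℝ≥0)

theorem norm_gaussianShift (θ : ℝ) : ‖gaussianShift ε θ‖ = ‖gaussianShift ε 0‖ := by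
  have h (t : ℝ) : eLpNorm (fun u : ℝ => gaussianPDFReal 0 ε (u - t)) 2 volume =
      eLpNorm (gaussianPDFReal 0 ε) 2 volume :=
    eLpNorm_comp_measurePreserving
      (stronglyMeasurable_gaussianPDFReal 0 ε).aestronglyMeasurable
      (measurePreserving_sub_right volume t)
  rw [gaussianShift, gaussianShift, Lp.norm_toLp, Lp.norm_toLp, h, h]

theorem integral_mul_gaussianPDFReal (f : RealL2) (θ : ℝ) :
    ∫ u, f u * gaussianPDFReal 0 ε (u - θ) = inner ℝ f (gaussianShift ε θ) := by
  rw [L2.inner_def]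
  refine integral_congr_ae ?_
  filter_upwards [(memLp_gaussianPDFReal_sub ε θ).coeFn_toLp] with u hu
  rw [gaussianShift, hu]
  simp [mul_comm]

theorem operatorTerm_projIcc (a b : ℝ) (S : PointConfig) (f : RealL2) (θ : ℝ) :
    operatorTerm ε S (projIcc a b f) θ =
      ((S.mult θ : ℝ) * inner ℝ f (projIcc a b (gaussianShift ε θ))) • gaussianShift ε θ := by
  rw [operatorTerm, integral_mul_gaussianPDFReal, inner_projIcc_comm]

theorem norm_projIcc_gaussianShift_le_of_forall_le {a b θ r : ℝ}
    (h : ∀ u ∈ Set.Icc a b, r ≤ (u - θ) ^ 2) :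
    ‖projIcc a b (gaussianShift ε θ)‖ ≤
      √(b - a) * ((√(2 * Real.pi * ε))⁻¹ * Real.exp (-r / (2 * ε))) := by
  refine norm_projIcc_toLp_le a b _ (by positivity) fun u hu => ?_
  rw [Real.norm_of_nonneg (gaussianPDFReal_nonneg _ _ _), gaussianPDFReal, sub_zero]
  have := h u hu
  gcongr

/-- Completing the square gives `(u - θ)² ≥ θ²/2 - u²`, and `u²` is bounded on `[a, b]`. -/
theorem norm_projIcc_gaussianShift_le (a b θ : ℝ) :
    ‖projIcc a b (gaussianShift ε θ)‖ ≤
      √(b - a) * ((√(2 * Real.pi * ε))⁻¹ * Real.exp (max (a ^ 2) (b ^ 2) / (2 * ε))) *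
        Real.exp (-θ ^ 2 / (4 * ε)) := by
  have h := norm_projIcc_gaussianShift_le_of_forall_le ε (a := a) (b := b) (θ := θ)
    (r := θ ^ 2 / 2 - max (a ^ 2) (b ^ 2)) fun u hu => by
      have : u ^ 2 ≤ max (a ^ 2) (b ^ 2) := by
        rcases le_total 0 u with h | h
        · exact le_max_of_le_right (pow_le_pow_left₀ h hu.2 2)
        · exact le_max_of_le_left (by nlinarith [hu.1])
      nlinarith [sq_nonneg (2 * u - θ)]
  refine h.trans_eq ?_
  rw [show -(θ ^ 2 / 2 - max (a ^ 2) (b ^ 2)) / (2 * (ε : ℝ)) =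
    max (a ^ 2) (b ^ 2) / (2 * ε) + -θ ^ 2 / (4 * ε) by ring, Real.exp_add]
  ring

end GaussianShift

/-! ### Gaussian sums over a configuration -/

namespace PointConfig

/-- Summability of Gaussian weights over a configuration of at most linear growth. -/
theorem summable_mult_mul_exp {S : PointConfig} {D : ℝ} (hD : 0 < D)
    (hS : ∀ R : ℝ, 1 ≤ R → S.count (Set.Icc (-R) R) ≤ ENNReal.ofReal (D * R)) {c : ℝ}
    (hc : 0 < c) : Summable fun θ : ℝ => (S.mult θ : ℝ) * Real.exp (-θ ^ 2 / c) := by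
  -- The shell `n ≤ |θ| ≤ n + 1` has at most `D(n+1)` points, each of weight at most `exp(-n/c)`
  -- because `θ² ≥ n² ≥ n`. Shells may overlap: only subadditivity is used.
  set A : ℕ → Set ℝ := fun n => {θ | (n : ℝ) ≤ |θ| ∧ |θ| ≤ n + 1}
  have hA (θ : ℝ) : θ ∈ A ⌊|θ|⌋₊ :=
    ⟨Nat.floor_le (abs_nonneg _), (Nat.lt_floor_add_one _).le⟩
  set w : ℝ → ℝ≥0∞ := fun θ => (S.mult θ : ℝ≥0∞) * ENNReal.ofReal (Real.exp (-θ ^ 2 / c))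
  have hsum : Summable fun n : ℕ => D * ((n : ℝ) + 1) * Real.exp (-c⁻¹ * n) := by
    have h1 := Real.summable_pow_mul_exp_neg_nat_mul 1 (inv_pos.2 hc)
    have h0 := Real.summable_pow_mul_exp_neg_nat_mul 0 (inv_pos.2 hc)
    refine ((h1.add h0).mul_left D).congr fun n => ?_
    ring
  have hle (n : ℕ) : ∑' θ : A n, w θ ≤
      ENNReal.ofReal (D * ((n : ℝ) + 1) * Real.exp (-c⁻¹ * n)) := by
    rw [ENNReal.ofReal_mul (by positivity)]
    calc ∑' θ : A n, w θ
        ≤ ∑' θ : A n, (S.mult θ : ℝ≥0∞) * ENNReal.ofReal (Real.exp (-c⁻¹ * n)) := by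
          refine ENNReal.tsum_le_tsum fun θ => mul_le_mul_right (ENNReal.ofReal_le_ofReal
            (Real.exp_le_exp.2 ?_)) _
          have h1 : (n : ℝ) ≤ (θ : ℝ) ^ 2 := by
            have h2 : (n : ℝ) ≤ (n : ℝ) ^ 2 := by exact_mod_cast Nat.le_self_pow two_ne_zero n
            rw [← sq_abs]
            exact h2.trans (pow_le_pow_left₀ n.cast_nonneg θ.2.1 2)
          rw [neg_div, neg_mul, neg_le_neg_iff, inv_mul_eq_div]
          gcongr
      _ = S.count (A n) * ENNReal.ofReal (Real.exp (-c⁻¹ * n)) := ENNReal.tsum_mul_right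
      _ ≤ _ := by
          refine mul_le_mul_left ((S.count_mono fun θ hθ => ?_).trans
            (hS (n + 1) (by simp))) _
          exact abs_le.1 hθ.2
  have hfin : ∑' θ, w θ ≠ ∞ := by
    have hU : (⋃ n, A n) = Set.univ :=
      Set.eq_univ_of_forall fun θ => Set.mem_iUnion.2 ⟨_, hA θ⟩
    have h := ENNReal.tsum_iUnion_le_tsum w A
    rw [hU, tsum_univ] at h
    exact ne_top_of_le_ne_top hsum.tsum_ofReal_ne_top (h.trans (ENNReal.tsum_le_tsum hle))
  refine (ENNReal.summable_toReal hfin).congr fun θ => ?_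
  rw [ENNReal.toReal_mul, ENNReal.toReal_ofReal (Real.exp_nonneg _), ENNReal.toReal_natCast]

theorem card_le_count (S : PointConfig) (a b : ℝ) :
    ((S.finite_Icc a b).toFinset.card : ℝ≥0∞) ≤ S.count (Set.Icc a b) := by
  have h : S.count (Set.Icc a b) =
      ∑' θ : ℝ, (Set.Icc a b).indicator (fun θ => (S.mult θ : ℝ≥0∞)) θ :=
    tsum_subtype (Set.Icc a b) fun θ => (S.mult θ : ℝ≥0∞)
  rw [h]
  refine le_trans ?_ (ENNReal.sum_le_tsum (S.finite_Icc a b).toFinset)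
  rw [← nsmul_one, ← Finset.sum_const]
  refine Finset.sum_le_sum fun θ hθ => ?_
  obtain ⟨h1, h2⟩ := (S.finite_Icc a b).mem_toFinset.1 hθ
  rw [Set.indicator_of_mem h2]
  exact_mod_cast Nat.one_le_iff_ne_zero.2 h1

end PointConfig

/-! ### Criteria for nuclearity and for Kolmogorov widths -/

/-- Allows the uncountable index set `ℝ`: summability makes the support countable, so it embeds in
`ℕ`, with zeros filling the gaps. -/
theorem isNuclear_of_hasSum {ι E F : Type*} [NormedAddCommGroup E] [NormedSpace ℝ E]
    [NormedAddCommGroup F] [NormedSpace ℝ F] {T : E → F} (φ : ι → E →L[ℝ] ℝ) (y : ι → F)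
    (hs : Summable fun i => ‖φ i‖ * ‖y i‖) (hT : ∀ x, HasSum (fun i => φ i x • y i) (T x)) :
    IsNuclear T := by
  set s : Set ι := Function.support fun i => ‖φ i‖ * ‖y i‖
  have : Encodable s := hs.countable_support.toEncodable
  have hinj : Function.Injective (Encodable.encode : s → ℕ) := Encodable.encode_injective
  have hext (k : ℕ) (h : ¬ ∃ i : s, Encodable.encode i = k) (x : E) :
      Function.extend Encodable.encode (fun i : s => φ i) 0 k x = 0 := by
    rw [Function.extend_apply' _ _ _ h]
    rfl
  refine ⟨Function.extend Encodable.encode (fun i : s => φ i) 0,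
    Function.extend Encodable.encode (fun i : s => y i) 0, ?_, fun x => ?_⟩
  · refine ((hasSum_extend_zero hinj).2 (hs.subtype s).hasSum).summable.congr fun k => ?_
    by_cases h : ∃ i : s, Encodable.encode i = k
    · obtain ⟨i, rfl⟩ := h
      simp [hinj.extend_apply]
    · simp [Function.extend_apply' _ _ _ h]
  · have hsub : (Function.support fun i => φ i x • y i) ⊆ s := by
      intro i hi h
      refine hi ?_
      rcases mul_eq_zero.1 h with h | h <;> simp [norm_eq_zero.1 h]
    refine ((hasSum_extend_zero hinj).2
      ((hasSum_subtype_iff_of_support_subset hsub).2 (hT x))).congr_fun fun k => ?_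
    by_cases h : ∃ i : s, Encodable.encode i = k
    · obtain ⟨i, rfl⟩ := h
      simp [hinj.extend_apply]
    · simp [Function.extend_apply' _ _ _ h]

theorem kolmogorovWidth_le_of_forall_exists {E : Type*} [NormedAddCommGroup E] [NormedSpace ℝ E]
    {K : Set E} {n : ℕ} (G : Finset E) (hG : G.card ≤ n) {r : ℝ}
    (h : ∀ x ∈ K, ∃ y ∈ Submodule.span ℝ (G : Set E), ‖x - y‖ ≤ r) :
    kolmogorovWidth K n ≤ ENNReal.ofReal r := by
  refine iInf₂_le_of_le (Submodule.span ℝ (G : Set E))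
    ⟨FiniteDimensional.span_finset ℝ G, (finrank_span_finset_le_card G).trans hG⟩ ?_
  refine iSup₂_le fun x hx => ?_
  obtain ⟨y, hy, hxy⟩ := h x hx
  refine (Metric.infEDist_le_edist_of_mem hy).trans ?_
  rw [edist_dist, dist_eq_norm]
  exact ENNReal.ofReal_le_ofReal hxy

/-! ### Nuclearity and width of `QAQ` -/

section Operator

variable {ε : ℝ≥0} {a b : ℝ} {S : PointConfig}

theorem summable_operatorTerm_projIcc
    (hS : Summable fun θ : ℝ => (S.mult θ : ℝ) * Real.exp (-θ ^ 2 / (4 * ε))) (f : RealL2) :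
    Summable (operatorTerm ε S (projIcc a b f)) := by
  set κ := √(b - a) * ((√(2 * Real.pi * ε))⁻¹ * Real.exp (max (a ^ 2) (b ^ 2) / (2 * ε)))
  refine Summable.of_norm_bounded (hS.mul_left (‖f‖ * κ * ‖gaussianShift ε 0‖)) fun θ => ?_
  rw [operatorTerm_projIcc, norm_smul, norm_mul, norm_gaussianShift, Real.norm_natCast]
  calc (S.mult θ : ℝ) * ‖inner ℝ f (projIcc a b (gaussianShift ε θ))‖ * ‖gaussianShift ε 0‖
      ≤ (S.mult θ : ℝ) * (‖f‖ * (κ * Real.exp (-θ ^ 2 / (4 * ε)))) * ‖gaussianShift ε 0‖ := by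
        gcongr
        refine (norm_inner_le_norm _ _).trans ?_
        gcongr
        exact norm_projIcc_gaussianShift_le ε a b θ
    _ = _ := by ring

theorem hasSum_operatorQAQ
    (hS : Summable fun θ : ℝ => (S.mult θ : ℝ) * Real.exp (-θ ^ 2 / (4 * ε))) (f : RealL2) :
    HasSum (fun θ => ((S.mult θ : ℝ) * inner ℝ f (projIcc a b (gaussianShift ε θ))) •
      projIcc a b (gaussianShift ε θ)) (operatorQAQ ε a b S f) := by
  refine ((summable_operatorTerm_projIcc hS f).hasSum.mapL (projIccCLM a b)).congr_fun fun θ => ?_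
  rw [operatorTerm_projIcc, map_smul, projIccCLM_apply]

theorem summable_mult_mul_norm_sq
    (hS : Summable fun θ : ℝ => (S.mult θ : ℝ) * Real.exp (-θ ^ 2 / (4 * ε))) :
    Summable fun θ => (S.mult θ : ℝ) * ‖projIcc a b (gaussianShift ε θ)‖ ^ 2 := by
  set κ := √(b - a) * ((√(2 * Real.pi * ε))⁻¹ * Real.exp (max (a ^ 2) (b ^ 2) / (2 * ε)))
  refine Summable.of_nonneg_of_le (fun θ => by positivity) (fun θ => ?_)
    (hS.mul_left (κ * ‖gaussianShift ε 0‖))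
  calc (S.mult θ : ℝ) * ‖projIcc a b (gaussianShift ε θ)‖ ^ 2
      ≤ (S.mult θ : ℝ) * ((κ * Real.exp (-θ ^ 2 / (4 * ε))) * ‖gaussianShift ε 0‖) := by
        rw [sq]
        gcongr
        · exact norm_projIcc_gaussianShift_le ε a b θ
        · exact (norm_projIcc_le a b _).trans_eq (norm_gaussianShift ε θ)
    _ = _ := by ring

theorem isNuclear_operatorQAQ
    (hS : Summable fun θ : ℝ => (S.mult θ : ℝ) * Real.exp (-θ ^ 2 / (4 * ε))) :
    IsNuclear (operatorQAQ ε a b S) := by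
  refine isNuclear_of_hasSum
    (fun θ => (S.mult θ : ℝ) • innerSL ℝ (projIcc a b (gaussianShift ε θ)))
    (fun θ => projIcc a b (gaussianShift ε θ)) ?_ fun f => ?_
  · refine (summable_mult_mul_norm_sq (a := a) (b := b) hS).congr fun θ => ?_
    rw [norm_smul, innerSL_apply_norm, Real.norm_natCast, sq, mul_assoc]
  · refine (hasSum_operatorQAQ hS f).congr_fun fun θ => ?_
    rw [smul_apply, innerSL_apply_apply, smul_eq_mul, real_inner_comm]

/-- Keep the terms with `θ ∈ F`; by Cauchy–Schwarz every other term has norm at most `mult(θ)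
‖g_θ‖²` on the unit ball. -/
theorem kolmogorovWidth_imageUnitBall_le
    (hS : Summable fun θ : ℝ => (S.mult θ : ℝ) * Real.exp (-θ ^ 2 / (4 * ε))) {n : ℕ}
    (F : Finset ℝ) (hF : F.card ≤ n) {v : ℝ → ℝ} (hv : Summable v) (hv0 : ∀ θ, 0 ≤ v θ)
    (h : ∀ θ ∉ F, (S.mult θ : ℝ) * ‖projIcc a b (gaussianShift ε θ)‖ ^ 2 ≤ v θ) :
    kolmogorovWidth (imageUnitBall ε a b S) n ≤ ENNReal.ofReal (∑' θ, v θ) := by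
  classical
  refine kolmogorovWidth_le_of_forall_exists
    (F.image fun θ => projIcc a b (gaussianShift ε θ)) (Finset.card_image_le.trans hF) ?_
  rintro _ ⟨f, ⟨-, hf⟩, rfl⟩
  have hsum := hasSum_operatorQAQ (a := a) (b := b) hS f
  set t : ℝ → RealL2 := fun θ =>
    ((S.mult θ : ℝ) * inner ℝ f (projIcc a b (gaussianShift ε θ))) •
      projIcc a b (gaussianShift ε θ)
  refine ⟨∑ θ ∈ F, t θ, Submodule.sum_mem _ fun θ hθ => Submodule.smul_mem _ _
    (Submodule.subset_span (Finset.mem_coe.2 (Finset.mem_image_of_mem _ hθ))), ?_⟩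
  rw [← hsum.tsum_eq, ← hsum.summable.sum_add_tsum_compl (s := F), add_sub_cancel_left]
  refine (tsum_of_norm_bounded (hv.subtype ((F : Set ℝ)ᶜ)).hasSum fun θ => ?_).trans
    (hv.tsum_subtype_le v _ hv0)
  refine le_trans ?_ (h θ θ.2)
  rw [norm_smul, norm_mul, Real.norm_natCast, sq, mul_assoc]
  gcongr
  refine (norm_inner_le_norm _ _).trans ?_
  exact mul_le_of_le_one_left (norm_nonneg _) hf

/-- For `θ > 2c` and `u ≤ b`, `θ - u ≥ (c - b) + (θ - c)` with both summands nonnegative and `θ - c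
> θ/2`, so `(u - θ)² ≥ (c - b)² + θ²/4`. The case `θ < -2c` is the mirror image, with `-a` for `b`.
-/
theorem norm_projIcc_gaussianShift_sq_le_of_lt_abs {c θ : ℝ} (hc : 0 ≤ c) (hb : b ≤ c)
    (ha : -a ≤ c) (hθ : 2 * c < |θ|) :
    ‖projIcc a b (gaussianShift ε θ)‖ ^ 2 ≤
      (√(b - a) * (√(2 * Real.pi * ε))⁻¹) ^ 2 *
        max (Real.exp (-(c - b) ^ 2 / ε)) (Real.exp (-(c + a) ^ 2 / ε)) *
          Real.exp (-θ ^ 2 / (4 * ε)) := by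
  have key {d : ℝ} (h : ∀ u ∈ Set.Icc a b, d ^ 2 + θ ^ 2 / 4 ≤ (u - θ) ^ 2) :
      ‖projIcc a b (gaussianShift ε θ)‖ ^ 2 ≤ (√(b - a) * (√(2 * Real.pi * ε))⁻¹) ^ 2 *
        Real.exp (-d ^ 2 / ε) * Real.exp (-θ ^ 2 / (4 * ε)) := by
    refine (pow_le_pow_left₀ (norm_nonneg _)
      (norm_projIcc_gaussianShift_le_of_forall_le ε h) 2).trans_eq ?_
    rw [← mul_assoc, mul_pow, ← Real.exp_nat_mul, mul_assoc _ (Real.exp _), ← Real.exp_add]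
    congr 2
    push_cast
    ring
  rcases lt_abs.1 hθ with h | h
  · refine (key (d := c - b) fun u hu => ?_).trans ?_
    · have := hu.2
      nlinarith [mul_nonneg (sub_nonneg.2 hb) hc]
    · gcongr
      exact le_max_left _ _
  · refine (key (d := c + a) fun u hu => ?_).trans ?_
    · have := hu.1
      nlinarith
    · gcongr
      exact le_max_right _ _

theorem exists_kolmogorovWidth_imageUnitBall_le (hε : 0 < ε) {D : ℝ} (hD : 0 < D)
    (hS : ∀ R : ℝ, 1 ≤ R → S.count (Set.Icc (-R) R) ≤ ENNReal.ofReal (D * R)) :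
    ∃ C : ℝ, 0 < C ∧ ∃ M : ℝ, ∀ᶠ n : ℕ in atTop,
      kolmogorovWidth (imageUnitBall ε a b S) n ≤
        ENNReal.ofReal (M * max (Real.exp (-(C * n - b) ^ 2 / ε))
          (Real.exp (-(C * n + a) ^ 2 / ε))) := by
  have hsum : Summable fun θ : ℝ => (S.mult θ : ℝ) * Real.exp (-θ ^ 2 / (4 * ε)) :=
    PointConfig.summable_mult_mul_exp hD hS (by positivity)
  have hC : 0 < (2 * D)⁻¹ := by positivity
  set κ := (√(b - a) * (√(2 * Real.pi * ε))⁻¹) ^ 2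
  -- With `c = n/(2D)`, the bound `D · 2c` on the points in `[-2c, 2c]` is exactly `n`.
  refine ⟨(2 * D)⁻¹, hC,
    κ * ∑' θ : ℝ, (S.mult θ : ℝ) * Real.exp (-θ ^ 2 / (4 * ε)), ?_⟩
  have hlim : Tendsto (fun n : ℕ => (2 * D)⁻¹ * (n : ℝ)) atTop atTop :=
    tendsto_natCast_atTop_atTop.const_mul_atTop hC
  filter_upwards [hlim.eventually_ge_atTop b, hlim.eventually_ge_atTop (-a),
    hlim.eventually_ge_atTop 1] with n hb ha h1
  set c := (2 * D)⁻¹ * (n : ℝ) with hc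
  set m := max (Real.exp (-(c - b) ^ 2 / ε)) (Real.exp (-(c + a) ^ 2 / ε))
  have hm : 0 ≤ m := le_max_of_le_left (Real.exp_nonneg _)
  have hcard : (S.finite_Icc (-(2 * c)) (2 * c)).toFinset.card ≤ n := by
    have h := (S.card_le_count (-(2 * c)) (2 * c)).trans (hS (2 * c) (by linarith))
    rw [show D * (2 * c) = n by rw [hc]; field_simp, ENNReal.ofReal_natCast] at h
    exact_mod_cast h
  refine (kolmogorovWidth_imageUnitBall_le hsum _ hcard (hsum.mul_left (κ * m))
    (fun θ => by positivity) fun θ hθ => ?_).trans_eq ?_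
  · rcases eq_or_ne (S.mult θ) 0 with h0 | h0
    · simp [h0]
    · have hθ' : 2 * c < |θ| := by
        by_contra! h
        exact hθ ((S.finite_Icc _ _).mem_toFinset.2 ⟨h0, abs_le.1 h⟩)
      refine (mul_le_mul_of_nonneg_left (norm_projIcc_gaussianShift_sq_le_of_lt_abs
        (zero_le_one.trans h1) hb ha hθ') (Nat.cast_nonneg _)).trans_eq ?_
      ring
  · rw [tsum_mul_left]
    congr 1
    ring

end Operator

theorem mainTheorem2 {Ω : Type*} [MeasurableSpace Ω] (P : Measure Ω) [IsProbabilityMeasure P]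
    (Θ : Ω → PointConfig) (hmeas : Measurable Θ) (herg : IsErgodicStationary P Θ)
    (hint : ∫⁻ ω, (Θ ω).count (Set.Ico 0 1) ∂P < ∞)
    (ε : ℝ≥0) (hε : 0 < ε) (a b : ℝ) (hab : a ≤ b) :
    ∀ᵐ ω ∂P,
      (∀ f : RealL2, Summable (operatorTerm ε (Θ ω) (projIcc a b f))) ∧
      IsNuclear (operatorQAQ ε a b (Θ ω)) ∧
      ∃ C : ℝ, 0 < C ∧ ∃ M : ℝ, ∀ᶠ n : ℕ in atTop,
        kolmogorovWidth (imageUnitBall ε a b (Θ ω)) n ≤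
          ENNReal.ofReal (M * max (Real.exp (-(C * n - b) ^ 2 / ε))
            (Real.exp (-(C * n + a) ^ 2 / ε))) := by
  have : VAddInvariantMeasure ℝ PointConfig (P.map Θ) := herg.toVAddInvariantMeasure
  rw [← lintegral_map (PointConfig.measurable_count measurableSet_Ico) hmeas] at hint
  filter_upwards [ae_of_ae_map hmeas.aemeasurable (PointConfig.ae_count_Icc_le_linear hint)]
    with ω ⟨D, hD, hS⟩
  have hsum := PointConfig.summable_mult_mul_exp hD hS (c := 4 * ε) (by positivity)
  exact ⟨summable_operatorTerm_projIcc hsum, isNuclear_operatorQAQ hsum,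
    exists_kolmogorovWidth_imageUnitBall_le hε hD hS⟩
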